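/- Let $\mathfrak H$ be a complex Hilbert space with inner product $(\cdot,\cdot)$. A fundamental symmetry in $\mathfrak H$ is a bounded operator $J$ on $\mathfrak H$ with $J^2=I$ and $J=J^*$; it is called nontrivial if $J\neq I$ and $J\neq -I$. A densely defined linear operator $A$ in $\mathfrak H$ is called $J$-self-adjoint if it coincides with its adjoint with respect to the indefinite inner product $[x,y]=(Jx,y)$. The resolvent set of $A$ is the set of all $z\in\mathbb C$ for which $A-zI$ has a bounded inverse defined on all of $\mathfrak H$. Let $S$ be a closed, densely defined, symmetric operator in $\mathfrak H$ with deficiency indices $\langle 2,2\rangle$, that is, $\dim\ker(S^*-iI)=\dim\ker(S^*+iI)=2$. Let $J$ and $R$ be fundamental symmetries in $\mathfrak H$ such that $$SJ=JS,\qquad SR=RS,\qquad JR=-RJ .$$ Then for every nontrivial fundamental symmetry $\widetilde J\in\operatorname{span}_{\mathbb C}\{I,J,R,JR\}$ there exists a $\widetilde J$-self-adjoint extension $A\supset S$ with empty resolvent set, $\rho(A)=\emptyset$. -/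

import Mathlib

namespace KreinExt

variable {H : Type*} [NormedAddCommGroup H] [InnerProductSpace ℂ H] [CompleteSpace H]

/-- A fundamental symmetry of the Hilbert space `H`: a bounded operator with
`J ^ 2 = I` and `J = J*`. -/
def IsFundamentalSymmetry (J : H →L[ℂ] H) : Prop :=
  J * J = 1 ∧ ContinuousLinearMap.adjoint J = J

/-- A nontrivial fundamental symmetry: one that is different from `I` and from `-I`. -/
def IsNontrivialFundamentalSymmetry (J : H →L[ℂ] H) : Prop :=
  IsFundamentalSymmetry J ∧ J ≠ 1 ∧ J ≠ -1

/-- The indefinite inner product `[x, y] = (J x, y)`. It is conjugate linear in the first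
variable, as is the inner product of Mathlib. -/
noncomputable def kreinInner (J : H →L[ℂ] H) (x y : H) : ℂ := inner ℂ (J x) y

/-- The operator `A` is `J`-self-adjoint: it is densely defined and coincides with its adjoint
with respect to `[·, ·]`. The graph of that adjoint consists of the pairs `(x, z)` with
`[A y, x] = [y, z]` for all `y` in the domain of `A`. -/
def IsJSelfAdjoint (J : H →L[ℂ] H) (A : H →ₗ.[ℂ] H) : Prop :=
  Dense (A.domain : Set H) ∧
    ∀ x z : H, (x, z) ∈ A.graph ↔
      ∀ y : A.domain, kreinInner J (A y) x = kreinInner J (y : H) z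

/-- The equality `S C = C S` of (partially defined) operators, for a bounded operator `C` defined
on all of `H`: the domain `{x | C x ∈ D(S)}` of `S C` is the domain `D(S)` of `C S`, and the two
operators agree there. -/
def CommutesWith (S : H →ₗ.[ℂ] H) (C : H →L[ℂ] H) : Prop :=
  (∀ x : H, C x ∈ S.domain ↔ x ∈ S.domain) ∧
    ∀ x y : S.domain, (y : H) = C (x : H) → S y = C (S x)

/-- A closed, densely defined, symmetric operator. -/
def IsClosedSymmetric (S : H →ₗ.[ℂ] H) : Prop :=
  S.IsClosed ∧ Dense (S.domain : Set H) ∧ S.IsFormalAdjoint S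

/-- The defect subspace `ker (S* - μ I)`. -/
noncomputable def defectSpace (S : H →ₗ.[ℂ] H) (μ : ℂ) : Submodule ℂ H :=
  (LinearMap.ker (S.adjoint.toFun - μ • S.adjoint.domain.subtype)).map S.adjoint.domain.subtype

/-- The densely defined symmetric operator `S` has the finite deficiency indices `⟨m, n⟩`, where
`m = dim ker (S* - i I)` and `n = dim ker (S* + i I)`. -/
def HasDeficiencyIndices (S : H →ₗ.[ℂ] H) (m n : ℕ) : Prop :=
  Module.rank ℂ (defectSpace S Complex.I) = m ∧
    Module.rank ℂ (defectSpace S (-Complex.I)) = n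

/-- The resolvent set of an operator `A`: all complex `z` for which `A - z I` has a bounded
inverse defined on the whole of `H`. -/
def resolventSet (A : H →ₗ.[ℂ] H) : Set ℂ :=
  {z | ∃ B : H →L[ℂ] H,
    (∀ y : H, ∃ h : B y ∈ A.domain, A ⟨B y, h⟩ - z • B y = y) ∧
      ∀ x : A.domain, B (A x - z • (x : H)) = (x : H)}

/-- The complex Clifford algebra spanned by `I`, `J`, `R` and `J R`. -/
def cliffordSpan (J R : H →L[ℂ] H) : Submodule ℂ (H →L[ℂ] H) :=
  Submodule.span ℂ {1, J, R, J * R}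

end KreinExt

/-! Write T for the given symmetry `J'`. The Clifford algebra contains a fundamental symmetry Q
anticommuting with T (`clifford_exists_anticommuting`), and both commute with S. Along the
eigenspaces of Q for 1 and -1, S splits as S₊ ⊕ S₋, and T exchanges the two summands. Take A = S₊* ⊕
S₋ (`modExtension`). Its Hilbert adjoint is S₊ ⊕ S₋*, which T conjugates back to A, so A is
T-self-adjoint.

Nonzero deficiency indices make every nonreal number an eigenvalue of S*. Since T intertwines S₊*
and S₋*, an eigenvector can be moved into the S₊* summand, hence into A. Nonreal eigenvalues
accumulate at every real point, which leaves no room for a resolvent set. -/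

namespace KreinExt

/-! ### Clifford algebra on two generators -/

section Clifford

variable {A : Type*} [Ring A] [Algebra ℂ A]

/-- The four basis elements of a Clifford algebra with two generators are linearly independent. -/
theorem clifford_coeff_eq_zero [Nontrivial A] {J R : A} (hJ : J * J = 1) (hR : R * R = 1)
    (hJR : J * R = -(R * J)) {a b c d : ℂ}
    (h : a • (1 : A) + b • J + c • R + d • (J * R) = 0) : a = 0 ∧ b = 0 ∧ c = 0 ∧ d = 0 := by
  have hRJ : R * J = -(J * R) := by rw [hJR, neg_neg]
  have hJJ : ∀ x : A, J * (J * x) = x := fun x => by rw [← mul_assoc, hJ, one_mul]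
  have two_ne : ∀ {x : A}, (2 : ℂ) • x = 0 → x = 0 := fun {x} hx =>
    (smul_eq_zero.mp hx).resolve_left two_ne_zero
  have key : ∀ p q : ℂ, p • (1 : A) + q • J = 0 → p = 0 ∧ q = 0 := by
    intro p q h1
    have h2 := congrArg (fun x => R * x * R) h1
    simp only [mul_add, add_mul, mul_smul_comm, smul_mul_assoc, mul_one, hR, hRJ, neg_mul,
      mul_assoc, mul_zero, zero_mul] at h2
    have hp : p • (1 : A) = 0 := two_ne (by linear_combination (norm := module) h1 + h2)
    have hp0 : p = 0 := (smul_eq_zero.mp hp).resolve_right one_ne_zero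
    refine ⟨hp0, ?_⟩
    subst hp0
    rw [zero_smul, zero_add] at h1
    have h3 := congrArg (fun x => x * J) h1
    simp only [smul_mul_assoc, hJ, zero_mul] at h3
    exact (smul_eq_zero.mp h3).resolve_right one_ne_zero
  -- Conjugation by `J` fixes `1`, `J` and negates `R`, `J * R`; adding the relation to its
  -- conjugate separates the pairs.
  have h2 := congrArg (fun x => J * x * J) h
  simp only [mul_add, add_mul, mul_smul_comm, smul_mul_assoc, mul_one, hJ, hRJ, hJJ,
    mul_assoc, mul_zero, zero_mul, mul_neg, smul_neg, one_mul] at h2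
  have h3 : a • (1 : A) + b • J = 0 := two_ne (by linear_combination (norm := module) h + h2)
  have h4 : c • R + d • (J * R) = 0 := by linear_combination (norm := module) h - h3
  have h5 := congrArg (fun x => x * R) h4
  simp only [add_mul, smul_mul_assoc, hR, mul_assoc, mul_one, zero_mul] at h5
  exact ⟨(key a b h3).1, (key a b h3).2, (key c d h5).1, (key c d h5).2⟩

/-- Every self-adjoint square root of `1` other than `1` and `-1` in a Clifford algebra with two
self-adjoint generators anticommutes with another self-adjoint square root of `1`. -/
theorem clifford_exists_anticommuting [StarRing A] [StarModule ℂ A] {J R : A}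
    (hJ : J * J = 1) (hR : R * R = 1) (sJ : star J = J) (sR : star R = R)
    (hJR : J * R = -(R * J)) {T : A} (hT : T ∈ Submodule.span ℂ {1, J, R, J * R})
    (hT2 : T * T = 1) (sT : star T = T) (hT1 : T ≠ 1) (hTn : T ≠ -1) :
    ∃ Q ∈ Submodule.span ℂ {1, J, R, J * R}, Q * Q = 1 ∧ star Q = Q ∧ T * Q = -(Q * T) := by
  have : Nontrivial A := ⟨⟨T, 1, hT1⟩⟩
  have hRJ : R * J = -(J * R) := by rw [hJR, neg_neg]
  have hJJ : ∀ x : A, J * (J * x) = x := fun x => by rw [← mul_assoc, hJ, one_mul]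
  have hRJx : ∀ x : A, R * (J * x) = -(J * (R * x)) := fun x => by
    rw [← mul_assoc, hRJ, neg_mul, mul_assoc]
  have mJ : J ∈ Submodule.span ℂ {1, J, R, J * R} := Submodule.subset_span (by simp)
  have mR : R ∈ Submodule.span ℂ {1, J, R, J * R} := Submodule.subset_span (by simp)
  obtain ⟨a, b, c, d, rfl⟩ : ∃ a b c d : ℂ, T = a • (1 : A) + b • J + c • R + d • (J * R) := by
    simp only [Submodule.mem_span_insert, Submodule.mem_span_singleton] at hT
    obtain ⟨a, _, ⟨b, _, ⟨c, _, ⟨d, rfl⟩, rfl⟩, rfl⟩, rfl⟩ := hT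
    exact ⟨a, b, c, d, by abel⟩
  simp only [mul_add, add_mul, mul_smul_comm, smul_mul_assoc, mul_one, one_mul, hJ, hR, hRJ, hJJ,
    hRJx, mul_assoc, mul_neg, smul_neg] at hT2
  obtain ⟨e1, e2, e3, e4⟩ := clifford_coeff_eq_zero hJ hR hJR
    (a := a * a + b * b + c * c - d * d - 1) (b := 2 * a * b) (c := 2 * a * c) (d := 2 * a * d)
    (by rw [← sub_eq_zero] at hT2; rw [← hT2]; module)
  -- The square of `T` has cross terms `2ab`, `2ac`, `2ad`, so a nonzero scalar part forces `T` to
  -- be scalar, hence `1` or `-1`.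
  have ha : a = 0 := by
    by_contra ha
    have hb : b = 0 := by simpa [ha] using e2
    have hc : c = 0 := by simpa [ha] using e3
    have hd : d = 0 := by simpa [ha] using e4
    subst hb hc hd
    have : (a - 1) * (a + 1) = 0 := by linear_combination e1
    rcases mul_eq_zero.mp this with h | h
    · exact hT1 (by simp [sub_eq_zero.mp h])
    · exact hTn (by simp [eq_neg_of_add_eq_zero_left h])
  subst ha
  simp only [star_add, star_smul, star_mul, star_one, sJ, sR, hRJ] at sT
  obtain ⟨-, s2, s3, -⟩ := clifford_coeff_eq_zero hJ hR hJR
    (a := 0) (b := star b - b) (c := star c - c) (d := - star d - d)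
    (by rw [← sub_eq_zero] at sT; rw [← sT]; simp only [star_zero]; module)
  -- Both `J` and `R` anticommute with `J * R`, so only `bJ + cR` matters: if it vanishes, `J`
  -- works; otherwise, as `b`, `c` are real, the normalised perpendicular vector in the plane of `J`
  -- and `R` does.
  by_cases hbc : b = 0 ∧ c = 0
  · obtain ⟨rfl, rfl⟩ := hbc
    refine ⟨J, mJ, hJ, sJ, ?_⟩
    simp only [zero_smul, zero_add, smul_mul_assoc, mul_smul_comm, hJJ, hRJ, mul_assoc, mul_neg,
      smul_neg]
  · obtain ⟨p, rfl⟩ := Complex.conj_eq_iff_real.mp (sub_eq_zero.mp s2)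
    obtain ⟨q, rfl⟩ := Complex.conj_eq_iff_real.mp (sub_eq_zero.mp s3)
    have hpos : 0 < p * p + q * q := by
      by_contra hn
      have hp : p = 0 := by nlinarith [mul_self_nonneg p, mul_self_nonneg q]
      have hq : q = 0 := by nlinarith [mul_self_nonneg p, mul_self_nonneg q]
      exact hbc (by simp [hp, hq])
    obtain ⟨r, hr⟩ : ∃ r : ℝ, r * r * (p * p + q * q) = 1 := by
      refine ⟨(√(p * p + q * q))⁻¹, ?_⟩
      rw [← mul_inv, Real.mul_self_sqrt hpos.le, inv_mul_cancel₀ hpos.ne']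
    have hrc : (r : ℂ) * r * (p * p + q * q) = 1 := by exact_mod_cast hr
    refine ⟨(r : ℂ) • (-(q : ℂ) • J + (p : ℂ) • R), Submodule.smul_mem _ _
      (Submodule.add_mem _ (Submodule.smul_mem _ _ mJ) (Submodule.smul_mem _ _ mR)), ?_, ?_, ?_⟩
    · simp only [mul_add, add_mul, mul_smul_comm, smul_mul_assoc, hJ, hR, hRJ]
      calc _ = ((r : ℂ) * r * (p * p + q * q)) • (1 : A) := by module
        _ = 1 := by rw [hrc, one_smul]
    · simp only [star_add, star_smul, sJ, sR, star_neg, Complex.star_def, Complex.conj_ofReal]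
    · simp only [mul_add, add_mul, mul_smul_comm, smul_mul_assoc, hJ, hR, hRJ, hJJ, hRJx,
        mul_assoc, mul_neg, mul_one, one_mul]
      module

end Clifford

variable {H : Type*} [NormedAddCommGroup H] [InnerProductSpace ℂ H] [CompleteSpace H]

local notation "⟪" x ", " y "⟫" => inner ℂ x y

/-! ### Graphs of adjoints and commuting bounded operators -/

theorem mem_adjoint_graph_iff {S : H →ₗ.[ℂ] H} (hS : Dense (S.domain : Set H)) (x z : H) :
    (x, z) ∈ S.adjoint.graph ↔ ∀ y : S.domain, ⟪S y, x⟫ = ⟪(y : H), z⟫ := by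
  rw [LinearPMap.adjoint_graph_eq_graph_adjoint hS, Submodule.mem_adjoint_iff]
  constructor
  · intro h y
    exact sub_eq_zero.mp (h _ _ (S.mem_graph y))
  · intro h a b hab
    obtain ⟨y, rfl, rfl⟩ := (LinearPMap.mem_graph_iff S).mp hab
    exact sub_eq_zero.mpr (h y)

/-- A closed operator contains the adjoint of its adjoint. -/
theorem mem_graph_of_forall_adjoint {S : H →ₗ.[ℂ] H} (hd : Dense (S.domain : Set H))
    (hc : S.IsClosed) {u v : H} (h : ∀ g k, (g, k) ∈ S.adjoint.graph → ⟪k, u⟫ = ⟪g, v⟫) :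
    (u, v) ∈ S.graph := by
  let e := WithLp.prodContinuousLinearEquiv 2 ℂ H H
  let K : Submodule ℂ (WithLp 2 (H × H)) := S.graph.comap (e : WithLp 2 (H × H) →ₗ[ℂ] H × H)
  have hK : IsClosed (K : Set (WithLp 2 (H × H))) := hc.preimage e.continuous
  have : CompleteSpace K := hK.completeSpace_coe
  have hmem : e.symm (u, v) ∈ Kᗮᗮ := by
    rw [Submodule.mem_orthogonal]
    intro w hw
    rw [Submodule.mem_orthogonal] at hw
    -- A quarter turn carries the orthogonal complement of the graph of `S` to the graph of `S*`.
    have hg : (w.snd, -w.fst) ∈ S.adjoint.graph := by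
      rw [mem_adjoint_graph_iff hd]
      intro y
      have := hw (e.symm ((y : H), S y)) (by
        change e (e.symm ((y : H), S y)) ∈ S.graph
        rw [e.apply_symm_apply]; exact S.mem_graph y)
      rw [WithLp.prod_inner_apply] at this
      rw [inner_neg_right]
      exact eq_neg_of_add_eq_zero_right this
    have := h _ _ hg
    rw [inner_neg_left] at this
    rw [WithLp.prod_inner_apply]
    change ⟪w.fst, u⟫ + ⟪w.snd, v⟫ = 0
    rw [← this, add_neg_cancel]
  rw [Submodule.orthogonal_orthogonal] at hmem
  have h2 : e (e.symm (u, v)) ∈ S.graph := hmem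
  rwa [e.apply_symm_apply] at h2

/-- The bounded operator `C` maps the graph of `S` into itself. -/
def PreservesGraph (S : H →ₗ.[ℂ] H) (C : H →L[ℂ] H) : Prop :=
  ∀ x z : H, (x, z) ∈ S.graph → (C x, C z) ∈ S.graph

omit [CompleteSpace H] in
theorem CommutesWith.preservesGraph {S : H →ₗ.[ℂ] H} {C : H →L[ℂ] H} (h : CommutesWith S C) :
    PreservesGraph S C := by
  intro x z hxz
  obtain ⟨y, rfl, rfl⟩ := (LinearPMap.mem_graph_iff S).mp hxz
  rw [← h.2 y ⟨C y, (h.1 y).mpr y.2⟩ rfl]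
  exact S.mem_graph ⟨C y, (h.1 y).mpr y.2⟩

omit [CompleteSpace H] in
theorem preservesGraph_of_mem_cliffordSpan {S : H →ₗ.[ℂ] H} {J R C : H →L[ℂ] H}
    (hJ : PreservesGraph S J) (hR : PreservesGraph S R) (hC : C ∈ cliffordSpan J R) :
    PreservesGraph S C := by
  induction hC using Submodule.span_induction with
  | mem C hC =>
    rcases hC with rfl | rfl | rfl | rfl
    · exact fun _ _ h => h
    · exact hJ
    · exact hR
    · exact fun x z h => hJ _ _ (hR _ _ h)
  | zero => exact fun _ _ _ => S.graph.zero_mem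
  | add C D _ _ hC hD => exact fun x z h => S.graph.add_mem (hC x z h) (hD x z h)
  | smul a C _ hC => exact fun x z h => S.graph.smul_mem a (hC x z h)

theorem PreservesGraph.adjoint {S : H →ₗ.[ℂ] H} (hS : Dense (S.domain : Set H)) {C : H →L[ℂ] H}
    (h : PreservesGraph S C) (hC : ContinuousLinearMap.adjoint C = C) :
    PreservesGraph S.adjoint C := by
  intro x z hxz
  rw [mem_adjoint_graph_iff hS] at hxz ⊢
  intro y
  obtain ⟨y', h1, h2⟩ := (LinearPMap.mem_graph_iff S).mp (h _ _ (S.mem_graph y))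
  simp only at h1 h2
  rw [← hC, ContinuousLinearMap.adjoint_inner_right, ContinuousLinearMap.adjoint_inner_right,
    ← h1, ← h2]
  exact hxz y'

/-! ### Defect spaces over the half planes -/

section Deficiency

variable {S : H →ₗ.[ℂ] H}

omit [CompleteSpace H] in
-- Symmetry makes `⟪x, S x⟫` real, so the imaginary part of `⟪x, S x - μ x⟫` comes from `μ` alone;
-- then Cauchy–Schwarz.
theorem abs_im_mul_norm_le (hsymm : S.IsFormalAdjoint S) (μ : ℂ) (x : S.domain) :
    |μ.im| * ‖(x : H)‖ ≤ ‖S x - μ • (x : H)‖ := by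
  rcases eq_or_ne (x : H) 0 with hx | hx
  · simp [hx]
  have hreal : (⟪(x : H), S x⟫).im = 0 := by
    rw [← Complex.conj_eq_iff_im, inner_conj_symm]
    exact hsymm x x
  have him : (⟪(x : H), S x - μ • (x : H)⟫).im = -(μ.im * ‖(x : H)‖ ^ 2) := by
    rw [inner_sub_right, inner_smul_right, Complex.sub_im, hreal, inner_self_eq_norm_sq_to_K]
    simp [Complex.mul_im, ← Complex.ofReal_pow]
  have h1 : |μ.im| * ‖(x : H)‖ ^ 2 ≤ ‖(x : H)‖ * ‖S x - μ • (x : H)‖ := by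
    calc |μ.im| * ‖(x : H)‖ ^ 2 = |(⟪(x : H), S x - μ • (x : H)⟫).im| := by
          rw [him, abs_neg, abs_mul, abs_of_nonneg (sq_nonneg ‖(x : H)‖)]
      _ ≤ ‖⟪(x : H), S x - μ • (x : H)⟫‖ := Complex.abs_im_le_norm _
      _ ≤ _ := norm_inner_le_norm _ _
  have hpos : 0 < ‖(x : H)‖ := norm_pos_iff.mpr hx
  nlinarith

/-- The range of `S - μ I`. -/
def shiftedRange (S : H →ₗ.[ℂ] H) (μ : ℂ) : Submodule ℂ H :=
  LinearMap.range (S.toFun - μ • S.domain.subtype)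

omit [CompleteSpace H] in
theorem mem_shiftedRange {μ : ℂ} {y : H} :
    y ∈ shiftedRange S μ ↔ ∃ x : S.domain, S x - μ • (x : H) = y := Iff.rfl

theorem isClosed_shiftedRange (hS : IsClosedSymmetric S) {μ : ℂ} (hμ : μ.im ≠ 0) :
    IsClosed (shiftedRange S μ : Set H) := by
  refine IsSeqClosed.isClosed fun y l hy hl => ?_
  choose x hx using hy
  have hx : ∀ n, S (x n) - μ • (x n : H) = y n := hx
  have hpos : 0 < |μ.im| := abs_pos.mpr hμ
  have hcau : CauchySeq fun n => (x n : H) := by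
    have hyc := hl.cauchySeq
    rw [Metric.cauchySeq_iff] at hyc ⊢
    intro ε hε
    obtain ⟨N, hN⟩ := hyc (|μ.im| * ε) (by positivity)
    refine ⟨N, fun m hm n hn => ?_⟩
    have h1 := hN m hm n hn
    have h2 := abs_im_mul_norm_le hS.2.2 μ (x m - x n)
    have h3 : S (x m - x n) - μ • ((x m - x n : S.domain) : H) = y m - y n := by
      rw [LinearPMap.map_sub, ← hx m, ← hx n, Submodule.coe_sub, smul_sub]
      abel
    rw [h3, Submodule.coe_sub] at h2
    rw [dist_eq_norm] at h1 ⊢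
    exact lt_of_mul_lt_mul_left (h2.trans_lt h1) hpos.le
  obtain ⟨a, ha⟩ := cauchySeq_tendsto_of_complete hcau
  have hSx : Filter.Tendsto (fun n => S (x n)) Filter.atTop (nhds (l + μ • a)) := by
    have : (fun n => S (x n)) = fun n => y n + μ • (x n : H) := by
      funext n; rw [← hx n]; abel
    rw [this]
    exact hl.add (ha.const_smul μ)
  have hmem : (a, l + μ • a) ∈ S.graph := by
    have hc : IsClosed (S.graph : Set (H × H)) := hS.1
    exact hc.mem_of_tendsto (ha.prodMk_nhds hSx) (Filter.Eventually.of_forall fun n =>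
      S.mem_graph (x n))
  obtain ⟨x', h1, h2⟩ := (LinearPMap.mem_graph_iff S).mp hmem
  refine mem_shiftedRange.mpr ⟨x', ?_⟩
  simp only at h1 h2
  rw [h2, h1, add_sub_cancel_right]

/-- Vanishing of a defect space of a closed symmetric operator propagates to nearby points. -/
theorem shiftedRange_orthogonal_eq_bot_of_near (hS : IsClosedSymmetric S) {μ ν : ℂ}
    (hμ : (shiftedRange S μ)ᗮ = ⊥) (hν : ‖ν - μ‖ < |μ.im|) : (shiftedRange S ν)ᗮ = ⊥ := by
  have hpos : 0 < |μ.im| := (norm_nonneg _).trans_lt hν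
  have : CompleteSpace (shiftedRange S μ) :=
    (isClosed_shiftedRange hS (abs_pos.mp hpos)).completeSpace_coe
  have htop : shiftedRange S μ = ⊤ := by
    rw [← Submodule.orthogonal_orthogonal (shiftedRange S μ), hμ, Submodule.bot_orthogonal_eq_top]
  rw [Submodule.eq_bot_iff]
  intro y hy
  by_contra hy0
  obtain ⟨x, hx⟩ := mem_shiftedRange.mp (htop ▸ Submodule.mem_top : y ∈ shiftedRange S μ)
  have h1 : ⟪y, S x - ν • (x : H)⟫ = 0 :=
    (Submodule.mem_orthogonal' _ _).mp hy _ (mem_shiftedRange.mpr ⟨x, rfl⟩)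
  -- With `y = (S - μ)x` orthogonal to `(S - ν)x`, this gives `‖y‖ ≤ |ν - μ|‖x‖`, against `|Im μ|‖x‖
  -- ≤ ‖y‖`.
  have h2 : ⟪y, y⟫ = (ν - μ) * ⟪y, (x : H)⟫ := by
    have : S x - ν • (x : H) = y - (ν - μ) • (x : H) := by
      nth_rw 1 [← hx]; module
    rw [this, inner_sub_right, inner_smul_right] at h1
    exact sub_eq_zero.mp h1
  have h3 : ‖y‖ * ‖y‖ ≤ ‖ν - μ‖ * (‖y‖ * ‖(x : H)‖) := by
    have h6 : ‖⟪y, y⟫‖ = ‖y‖ * ‖y‖ := by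
      simp [inner_self_eq_norm_sq_to_K, sq]
    rw [← h6, h2, norm_mul]
    gcongr
    exact norm_inner_le_norm _ _
  have h4 := abs_im_mul_norm_le hS.2.2 μ x
  rw [hx] at h4
  have hy1 : 0 < ‖y‖ := norm_pos_iff.mpr hy0
  have h5 : ‖y‖ ≤ ‖ν - μ‖ * ‖(x : H)‖ := by nlinarith
  have hx1 : 0 < ‖(x : H)‖ := by
    by_contra hn
    have : ‖(x : H)‖ = 0 := le_antisymm (not_lt.mp hn) (norm_nonneg _)
    rw [this, mul_zero] at h5
    linarith
  nlinarith

/-- Vanishing of a defect space of a closed symmetric operator propagates over a half plane. -/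
theorem shiftedRange_orthogonal_eq_bot_of_halfPlane (hS : IsClosedSymmetric S) {σ : ℝ}
    {μ ν : ℂ} (hμ : (shiftedRange S μ)ᗮ = ⊥) (hμσ : 0 < σ * μ.im) (hνσ : 0 < σ * ν.im) :
    (shiftedRange S ν)ᗮ = ⊥ := by
  let s : Set ℂ := {z | 0 < σ * z.im}
  let u : Set ℂ := {z | z ∈ s ∧ (shiftedRange S z)ᗮ = ⊥}
  have hcont : Continuous fun z : ℂ => σ * z.im := continuous_const.mul Complex.continuous_im
  have hs : IsPreconnected s := by
    refine Convex.isPreconnected fun z hz w hw a b ha hb hab => ?_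
    simp only [s, Set.mem_ofPred_eq, Complex.add_im, Complex.real_smul,
      Complex.im_ofReal_mul] at hz hw ⊢
    rcases ha.eq_or_lt with rfl | ha
    · nlinarith
    · nlinarith [mul_pos ha hz, mul_nonneg hb hw.le]
  have hso : IsOpen s := isOpen_lt continuous_const hcont
  have him : ∀ z ∈ s, 0 < |z.im| := fun z hz => abs_pos.mpr fun h => by simp [s, h] at hz
  have hu : IsOpen u := by
    rw [Metric.isOpen_iff]
    intro z hz
    obtain ⟨ε, hε, hball⟩ := Metric.isOpen_iff.mp hso z hz.1
    refine ⟨min ε |z.im|, lt_min hε (him z hz.1), fun w hw => ⟨hball ?_, ?_⟩⟩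
    · exact Metric.ball_subset_ball (min_le_left _ _) hw
    · refine shiftedRange_orthogonal_eq_bot_of_near hS hz.2 ?_
      rw [← dist_eq_norm]
      exact (Metric.mem_ball.mp hw).trans_le (min_le_right _ _)
  have hsub : s ⊆ u := by
    refine hs.subset_of_closure_inter_subset hu ⟨μ, hμσ, hμσ, hμ⟩ ?_
    rintro z ⟨hzc, hzs⟩
    refine ⟨hzs, ?_⟩
    -- The admissible radius depends on the approximating point `w`, not on `z`; the condition is
    -- open and holds at `w = z`.
    have ho : IsOpen {w : ℂ | ‖z - w‖ < |w.im|} :=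
      isOpen_lt (by fun_prop) (Complex.continuous_im.abs)
    obtain ⟨w, hw, hwu⟩ := mem_closure_iff.mp hzc _ ho (by simpa using him z hzs)
    exact shiftedRange_orthogonal_eq_bot_of_near hS hwu.2 hw
  exact (hsub hνσ).2

theorem mem_shiftedRange_orthogonal_iff (hS : Dense (S.domain : Set H)) {μ : ℂ} {f : H} :
    f ∈ (shiftedRange S (starRingEnd ℂ μ))ᗮ ↔ (f, μ • f) ∈ S.adjoint.graph := by
  rw [Submodule.mem_orthogonal, mem_adjoint_graph_iff hS]
  have key : ∀ y : S.domain, ⟪S y - (starRingEnd ℂ μ) • (y : H), f⟫ = 0 ↔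
      ⟪S y, f⟫ = ⟪(y : H), μ • f⟫ := by
    intro y
    rw [inner_sub_left, inner_smul_left, inner_smul_right, Complex.conj_conj, sub_eq_zero]
  constructor
  · intro h y
    exact (key y).mp (h _ (mem_shiftedRange.mpr ⟨y, rfl⟩))
  · rintro h _ ⟨y, rfl⟩
    exact (key y).mpr (h y)

theorem shiftedRange_orthogonal_ne_bot (hS : Dense (S.domain : Set H)) {μ : ℂ}
    (h : Module.rank ℂ (defectSpace S μ) ≠ 0) : (shiftedRange S (starRingEnd ℂ μ))ᗮ ≠ ⊥ := by
  intro hbot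
  refine h ?_
  rw [Submodule.rank_eq_zero, Submodule.eq_bot_iff]
  rintro _ ⟨f, hf, rfl⟩
  have hf' : S.adjoint f = μ • (f : H) := sub_eq_zero.mp hf
  have hmem : (f : H) ∈ (shiftedRange S (starRingEnd ℂ μ))ᗮ := by
    rw [mem_shiftedRange_orthogonal_iff hS, ← hf']
    exact S.adjoint.mem_graph f
  rwa [hbot, Submodule.mem_bot] at hmem

/-- If both deficiency indices are nonzero, every nonreal number is an eigenvalue of `S*`. -/
theorem exists_adjoint_eigenvector (hS : IsClosedSymmetric S)
    (h₁ : Module.rank ℂ (defectSpace S Complex.I) ≠ 0)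
    (h₂ : Module.rank ℂ (defectSpace S (-Complex.I)) ≠ 0) {μ : ℂ} (hμ : μ.im ≠ 0) :
    ∃ f : H, f ≠ 0 ∧ (f, μ • f) ∈ S.adjoint.graph := by
  suffices h : (shiftedRange S (starRingEnd ℂ μ))ᗮ ≠ ⊥ by
    obtain ⟨f, hf, hf0⟩ := Submodule.exists_mem_ne_zero_of_ne_bot h
    exact ⟨f, hf0, (mem_shiftedRange_orthogonal_iff hS.2.1).mp hf⟩
  intro hbot
  rcases hμ.lt_or_gt with hneg | hpos
  · refine shiftedRange_orthogonal_ne_bot hS.2.1 h₂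
      (shiftedRange_orthogonal_eq_bot_of_halfPlane hS (σ := 1) hbot ?_ ?_) <;> simp [hneg]
  · refine shiftedRange_orthogonal_ne_bot hS.2.1 h₁
      (shiftedRange_orthogonal_eq_bot_of_halfPlane hS (σ := -1) hbot ?_ ?_) <;> simp [hpos]

end Deficiency

/-! ### The extension and its self-adjointness -/

section Extension

variable {S : H →ₗ.[ℂ] H}

/-- The restriction of `S*` to the vectors whose component in the eigenspace of `R` for `-1`
lies in the domain of `S`. -/
noncomputable def modExtension (S : H →ₗ.[ℂ] H) (R : H →L[ℂ] H) : H →ₗ.[ℂ] H :=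
  S.adjoint.domRestrict (S.domain.comap (LinearMap.id - (R : H →ₗ[ℂ] H)))

theorem mem_modExtension_graph {R : H →L[ℂ] H} {x z : H} :
    (x, z) ∈ (modExtension S R).graph ↔ (x, z) ∈ S.adjoint.graph ∧ x - R x ∈ S.domain := by
  constructor
  · intro h
    obtain ⟨y, rfl, rfl⟩ := (LinearPMap.mem_graph_iff _).mp h
    refine ⟨?_, y.2.1⟩
    exact S.adjoint.mem_graph ⟨y, y.2.2⟩
  · rintro ⟨h, hx⟩
    obtain ⟨y, rfl, rfl⟩ := (LinearPMap.mem_graph_iff _).mp h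
    refine (LinearPMap.mem_graph_iff _).mpr ⟨⟨y, hx, y.2⟩, rfl, ?_⟩
    exact LinearPMap.domRestrict_apply rfl

theorem le_modExtension (hS : IsClosedSymmetric S) {R : H →L[ℂ] H} (hR : PreservesGraph S R) :
    S ≤ modExtension S R := by
  refine LinearPMap.le_of_le_graph ?_
  rintro ⟨x, z⟩ hxz
  refine mem_modExtension_graph.mpr ⟨LinearPMap.le_graph_of_le
    (hS.2.2.le_adjoint hS.2.1) hxz, ?_⟩
  exact S.domain.sub_mem (LinearPMap.mem_domain_of_mem_graph hxz)
    (LinearPMap.mem_domain_of_mem_graph (hR _ _ hxz))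

theorem inner_adjoint_of_mem_domain (hS : IsClosedSymmetric S) {x z g k : H}
    (hxz : (x, z) ∈ S.adjoint.graph) (hx : x ∈ S.domain) (hgk : (g, k) ∈ S.adjoint.graph) :
    ⟪z, g⟫ = ⟪x, k⟫ := by
  have h1 : (x, S ⟨x, hx⟩) ∈ S.adjoint.graph :=
    LinearPMap.le_graph_of_le (hS.2.2.le_adjoint hS.2.1) (S.mem_graph ⟨x, hx⟩)
  have h2 : z = S ⟨x, hx⟩ := LinearPMap.mem_graph_snd_inj _ hxz h1 rfl
  rw [h2]
  exact (mem_adjoint_graph_iff hS.2.1 g k).mp hgk ⟨x, hx⟩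

theorem isJSelfAdjoint_modExtension (hS : IsClosedSymmetric S) {J R : H →L[ℂ] H}
    (hJ : IsFundamentalSymmetry J) (hR : IsFundamentalSymmetry R)
    (hSJ : PreservesGraph S J) (hSR : PreservesGraph S R) (hJR : J * R = -(R * J)) :
    IsJSelfAdjoint J (modExtension S R) := by
  have hle := le_modExtension hS hSR
  have aJ := hSJ.adjoint hS.2.1 hJ.2
  have aR := hSR.adjoint hS.2.1 hR.2
  have J2 : ∀ x, J (J x) = x := fun x => congrArg (fun T : H →L[ℂ] H => T x) hJ.1
  have R2 : ∀ x, R (R x) = x := fun x => congrArg (fun T : H →L[ℂ] H => T x) hR.1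
  have JR : ∀ x, J (R x) = -R (J x) := fun x => congrArg (fun T : H →L[ℂ] H => T x) hJR
  have symR : ∀ x y, ⟪R x, y⟫ = ⟪x, R y⟫ := fun x y => by
    nth_rw 1 [← hR.2]; exact ContinuousLinearMap.adjoint_inner_left R y x
  have domJ : ∀ x ∈ S.domain, J x ∈ S.domain := fun x hx =>
    LinearPMap.mem_domain_of_mem_graph (hSJ _ _ (S.mem_graph ⟨x, hx⟩))
  refine ⟨hS.2.1.mono hle.1, fun x z => ⟨fun h y => ?_, fun h => ?_⟩⟩
  · obtain ⟨hxz, hx⟩ := mem_modExtension_graph.mp h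
    obtain ⟨hyw, hy⟩ := mem_modExtension_graph.mp ((modExtension S R).mem_graph y)
    generalize (modExtension S R) y = w at hyw ⊢
    generalize (y : H) = y at hyw hy ⊢
    simp only [kreinInner]
    have hg := aJ _ _ hyw
    -- `J` swaps the eigenspaces of `R`, so `x - R x` and `J y + R J y = J (y - R y)` both lie in
    -- the domain of `S`: in each half of the pairing one argument has no boundary term.
    have e1 := inner_adjoint_of_mem_domain hS (S.adjoint.graph.sub_mem hxz (aR _ _ hxz)) hx hg
    have e2 := inner_adjoint_of_mem_domain hS
      (S.adjoint.graph.add_mem hg (aR _ _ hg)) (by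
        have := domJ _ hy
        rwa [map_sub, JR, sub_neg_eq_add] at this) hxz
    have e1' := congrArg (starRingEnd ℂ) e1
    rw [inner_conj_symm, inner_conj_symm] at e1'
    simp only [inner_sub_right, inner_add_left, symR] at e1' e2
    linear_combination (e2 - e1') / 2
  · have hxz : (x, z) ∈ S.adjoint.graph := by
      rw [mem_adjoint_graph_iff hS.2.1]
      intro y
      obtain ⟨y', h1, h2⟩ := (LinearPMap.mem_graph_iff _).mp
        (LinearPMap.le_graph_of_le hle (hSJ _ _ (S.mem_graph y)))
      have := h y'
      rwa [kreinInner, kreinInner, h1, h2, J2, J2] at this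
    refine mem_modExtension_graph.mpr ⟨hxz, ?_⟩
    refine LinearPMap.mem_domain_of_mem_graph (y := z - R z)
      (mem_graph_of_forall_adjoint hS.2.1 hS.1 fun g k hgk => ?_)
    have hf := aJ _ _ hgk
    -- Test vectors `(I + R) J g` are admissible as `(I - R)(I + R) = 0`. Since `J (I + R) J = I -
    -- R`, they yield the `S** = S` criterion for `x - R x`.
    have hy : (J g + R (J g), J k + R (J k)) ∈ (modExtension S R).graph := by
      refine mem_modExtension_graph.mpr ⟨S.adjoint.graph.add_mem hf (aR _ _ hf), ?_⟩
      rw [map_add, R2, add_comm (R (J g)), sub_self]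
      exact S.domain.zero_mem
    obtain ⟨y', h1, h2⟩ := (LinearPMap.mem_graph_iff _).mp hy
    have := h y'
    simp only at h1 h2
    rw [kreinInner, kreinInner, h1, h2, map_add, map_add, JR, JR, J2, J2] at this
    simpa only [inner_add_left, inner_neg_left, inner_sub_left, symR, inner_sub_right, ← sub_eq_add_neg] using this

theorem exists_modExtension_eigenvector (hS : IsClosedSymmetric S) {J R : H →L[ℂ] H}
    (hJ : IsFundamentalSymmetry J) (hR : IsFundamentalSymmetry R)
    (hSJ : PreservesGraph S J) (hSR : PreservesGraph S R) (hJR : J * R = -(R * J))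
    {μ : ℂ} (hμ : ∃ f : H, f ≠ 0 ∧ (f, μ • f) ∈ S.adjoint.graph) :
    ∃ f : H, f ≠ 0 ∧ (f, μ • f) ∈ (modExtension S R).graph := by
  obtain ⟨f, hf0, hf⟩ := hμ
  have R2 : ∀ x, R (R x) = x := fun x => congrArg (fun T : H →L[ℂ] H => T x) hR.1
  have J2 : ∀ x, J (J x) = x := fun x => congrArg (fun T : H →L[ℂ] H => T x) hJ.1
  have JR : ∀ x, J (R x) = -R (J x) := fun x => congrArg (fun T : H →L[ℂ] H => T x) hJR
  have key : ∀ g, (g, μ • g) ∈ S.adjoint.graph →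
      (g + R g, μ • (g + R g)) ∈ (modExtension S R).graph := by
    intro g hg
    refine mem_modExtension_graph.mpr ⟨?_, ?_⟩
    · have := S.adjoint.graph.add_mem hg (hSR.adjoint hS.2.1 hR.2 _ _ hg)
      rwa [Prod.mk_add_mk, map_smul, ← smul_add] at this
    · rw [map_add, R2, add_comm (R g), sub_self]
      exact S.domain.zero_mem
  -- If `R f = -f`, then `J f` is a nonzero eigenvector fixed by `R`.
  by_cases h : f + R f = 0
  · refine ⟨J f + R (J f), fun h' => hf0 ?_, key _ ?_⟩
    · have h1 := congrArg J h
      rw [map_add, JR, map_zero] at h1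
      have h2 : (2 : ℂ) • J f = 0 := by linear_combination (norm := module) h1 + h'
      rw [← J2 f, (smul_eq_zero.mp h2).resolve_left two_ne_zero, map_zero]
    · have := hSJ.adjoint hS.2.1 hJ.2 _ _ hf
      rwa [map_smul] at this
  · exact ⟨_, h, key f hf⟩

end Extension

/-! ### Emptiness of the resolvent set -/

omit [CompleteSpace H] in
/-- An operator for which every nonreal number is an eigenvalue has empty resolvent set. -/
theorem resolventSet_eq_empty {A : H →ₗ.[ℂ] H}
    (hA : ∀ μ : ℂ, μ.im ≠ 0 → ∃ f : H, f ≠ 0 ∧ (f, μ • f) ∈ A.graph) : resolventSet A = ∅ := by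
  rw [Set.eq_empty_iff_forall_notMem]
  rintro z ⟨B, -, hB⟩
  -- An eigenvector `f` for `μ` satisfies `f = (μ - z) B f`, impossible once `μ` is this close to
  -- `z`.
  obtain ⟨μ, hμ, hd⟩ : ∃ μ : ℂ, μ.im ≠ 0 ∧ ‖μ - z‖ * ‖B‖ < 1 := by
    by_cases hz : z.im = 0
    · have hpos : 0 < (‖B‖ + 1)⁻¹ := by positivity
      refine ⟨z + ((‖B‖ + 1)⁻¹ : ℝ) * Complex.I, ?_, ?_⟩
      · simp only [Complex.add_im, hz, Complex.im_ofReal_mul, Complex.I_im, mul_one, zero_add]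
        exact hpos.ne'
      · rw [add_sub_cancel_left, norm_mul, Complex.norm_I, mul_one, Complex.norm_real,
          Real.norm_of_nonneg hpos.le, inv_mul_lt_one₀ (by positivity)]
        linarith
    · exact ⟨z, hz, by simp⟩
  obtain ⟨f, hf0, hf⟩ := hA μ hμ
  obtain ⟨x, h1, h2⟩ := (LinearPMap.mem_graph_iff _).mp hf
  simp only at h1 h2
  have h3 := hB x
  rw [h1, h2, ← sub_smul, map_smul] at h3
  have h4 : ‖f‖ ≤ ‖μ - z‖ * (‖B‖ * ‖f‖) := by
    nth_rw 1 [← h3]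
    rw [norm_smul]
    gcongr
    exact B.le_opNorm f
  have : 0 < ‖f‖ := norm_pos_iff.mpr hf0
  nlinarith

end KreinExt

theorem corollary4p2 {H : Type*} [NormedAddCommGroup H] [InnerProductSpace ℂ H] [CompleteSpace H]
    (S : H →ₗ.[ℂ] H) (hS : KreinExt.IsClosedSymmetric S)
    (hdef : KreinExt.HasDeficiencyIndices S 2 2)
    (J R : H →L[ℂ] H)
    (hJ : KreinExt.IsFundamentalSymmetry J) (hR : KreinExt.IsFundamentalSymmetry R)
    (hSJ : KreinExt.CommutesWith S J) (hSR : KreinExt.CommutesWith S R)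
    (hJR : J * R = -(R * J))
    (J' : H →L[ℂ] H) (hJ' : J' ∈ KreinExt.cliffordSpan J R)
    (hJ'sym : KreinExt.IsNontrivialFundamentalSymmetry J') :
    ∃ A : H →ₗ.[ℂ] H, S ≤ A ∧ KreinExt.IsJSelfAdjoint J' A ∧ KreinExt.resolventSet A = ∅ := by

  obtain ⟨R', hR', hR2, sR, hanti⟩ := KreinExt.clifford_exists_anticommuting hJ.1 hR.1 hJ.2 hR.2
    hJR hJ' hJ'sym.1.1 hJ'sym.1.2 hJ'sym.2.1 hJ'sym.2.2
  have hR's : KreinExt.IsFundamentalSymmetry R' := ⟨hR2, sR⟩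
  have pJ := KreinExt.preservesGraph_of_mem_cliffordSpan hSJ.preservesGraph hSR.preservesGraph hJ'
  have pR := KreinExt.preservesGraph_of_mem_cliffordSpan hSJ.preservesGraph hSR.preservesGraph hR'
  refine ⟨KreinExt.modExtension S R', KreinExt.le_modExtension hS pR,
    KreinExt.isJSelfAdjoint_modExtension hS hJ'sym.1 hR's pJ pR hanti,
    KreinExt.resolventSet_eq_empty fun μ hμ => ?_⟩
  refine KreinExt.exists_modExtension_eigenvector hS hJ'sym.1 hR's pJ pR hanti
    (KreinExt.exists_adjoint_eigenvector hS ?_ ?_ hμ)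
  · rw [hdef.1]; norm_num
  · rw [hdef.2]; norm_num
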